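/- Let $m\ge 3$ and $n\ge (m+3)^2/2+1$ be integers. Let $C_m\times C_n$ be the Cartesian product of two cycles, with vertices $v(i,j)$ ($i\in\mathbb Z_m$, $j\in\mathbb Z_n$), and for $j\in\mathbb Z_n$ let the red cycle $R(j)$ be the $m$-cycle on the vertices $v(i,j)$, $i\in\mathbb Z_m$. In a drawing of a graph in the plane, vertices are distinct points, each edge is an open arc (the image of a continuous locally injective map of $(0,1)$, extending continuously to $[0,1]$) whose end points are the points of its two end vertices, and no edge contains a vertex. Let $\mathcal D$ be a drawing of $C_m\times C_n$ in which every intersection point of two different edges is a crossing, that is, each of the two edges passes through the point exactly once and they are not tangential there. (Edges may intersect themselves, adjacent edges may cross, and two edges may cross more than once.) Then $\mathcal D$ is robust, or some red cycle $R(j)$ has at least $m$ crossings, where the crossings of $R(j)$ are the pairwise intersections of two different edges of which at least one belongs to $R(j)$ (a point common to several pairs of edges counts once for each pair). Here $\mathcal D$ is robust if the following two conditions hold. (1) For any three different red cycles $R,R',R''$ some component of $\mathbb R^2\setminus R$ intersects both $R'$ and $R''$. (2) For every $j\in\mathbb Z_n$ the following numbers $b(j)$ and $a(j)$ exist, and,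 as integers, $a(j)+b(j)<n/2$: $b(j)$ is the least $b\in\{0,\dots,n-1\}$ such that $R(j-b)\ne R(j)$ and no edge of $R(j-b)$ intersects an edge of $R(j)$; and $a(j)$ is the least $a\in\{0,\dots,n-1\}$ such that $R(j+a)$ is none of the cycles $R(j-c)$, $0\le c\le b(j)$, and no edge of $R(j+a)$ intersects an edge of any of these cycles (indices modulo $n$). -/

import Mathlib

open scoped unitInterval

/-- The plane `ℝ²`, with coordinates `z.re` and `z.im`. -/
abbrev Plane : Type := ℂ

/-- The open arc traced by `γ : [0,1] → ℝ²`, that is, the image of `(0,1)`. -/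
def openArc (γ : C(I, Plane)) : Set Plane := γ '' Set.Ioo 0 1

/-- A drawing of a simple graph in the plane. Vertices are distinct points. Every edge is an open
arc, given by a continuous map on `[0,1]` that is locally injective on `(0,1)`, whose end points
are the points of the two ends of the edge. No edge contains a vertex. Edges may intersect
themselves and each other in an arbitrary way. -/
structure Drawing {V : Type*} (G : SimpleGraph V) where
  /-- the point that represents a vertex -/
  point : V → Plane
  /-- the parametrized closure of the open arc that represents an edge -/
  arc : G.edgeSet → C(I, Plane)
  point_injective : Function.Injective point
  arc_locally_injective : ∀ e, ∀ t ∈ Set.Ioo (0 : I) 1,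
    ∃ U ∈ nhds t, Set.InjOn (arc e) (U ∩ Set.Ioo 0 1)
  arc_ends : ∀ e : G.edgeSet, s(arc e 0, arc e 1) = Sym2.map point e.1
  vertex_notMem_arc : ∀ e v, point v ∉ openArc (arc e)

/-- The intersection point `x` of the two open arcs traced by `γ` and `δ` is a crossing: each of
the arcs passes through `x` exactly once, and, up to a homeomorphism of the plane, near `x` they
are two lines that cross at a right angle. (By the Schoenflies theorem this says that on the
boundary of a small disc around `x` the ends of the two subarcs alternate, i.e. that the
intersection cannot be removed by an isotopy in the disc that fixes the boundary.) -/
def IsCrossing (γ δ : C(I, Plane)) (x : Plane) : Prop :=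
  (∃! t, t ∈ Set.Ioo (0 : I) 1 ∧ γ t = x) ∧
  (∃! t, t ∈ Set.Ioo (0 : I) 1 ∧ δ t = x) ∧
  ∃ Φ : Plane ≃ₜ Plane, Φ 0 = x ∧ ∀ z : Plane, ‖z‖ < 1 →
    (Φ z ∈ openArc γ ↔ z.im = 0) ∧ (Φ z ∈ openArc δ ↔ z.re = 0)

/-- `C` separates `C'` from `C''`: no component of the complement of `C` intersects both. -/
def Separates (C C' C'' : Set Plane) : Prop :=
  ∀ x ∈ Cᶜ, ¬ ((connectedComponentIn Cᶜ x ∩ C').Nonempty ∧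
    (connectedComponentIn Cᶜ x ∩ C'').Nonempty)

/-- No member of the family separates two further members from each other. -/
def Nonseparating {ι : Type*} (C : ι → Set Plane) : Prop :=
  ∀ j k l, j ≠ k → j ≠ l → k ≠ l → ¬ Separates (C j) (C k) (C l)

/-- The Cartesian product `C_m × C_n` of two cycles, with vertices `(i, j)`. -/
abbrev cycleProduct (m n : ℕ) : SimpleGraph (Fin m × Fin n) :=
  (SimpleGraph.cycleGraph m).boxProd (SimpleGraph.cycleGraph n)

/-- The edges of the red cycle `R(j)`, the `m`-cycle on the vertices `(i, j)`. -/
def redEdges {m n : ℕ} (j : Fin n) : Set (cycleProduct m n).edgeSet :=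
  {e | ∀ v ∈ e.1, v.2 = j}

namespace Drawing

/-- The open arc that represents the edge `e`. -/
def edge {V : Type*} {G : SimpleGraph V} (D : Drawing G) (e : G.edgeSet) : Set Plane :=
  openArc (D.arc e)

/-- Every intersection of two different edges is a crossing. -/
def AllIntersectionsCross {V : Type*} {G : SimpleGraph V} (D : Drawing G) : Prop :=
  ∀ e f : G.edgeSet, e ≠ f → ∀ x ∈ D.edge e ∩ D.edge f, IsCrossing (D.arc e) (D.arc f) x

/-- The set of pairwise intersections of edges that involve an edge in `H` and another edge in
`K`. A pairwise intersection is an unordered pair of different edges with a common point. -/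
def inter {V : Type*} {G : SimpleGraph V} (D : Drawing G) (H K : Set G.edgeSet) :
    Set (Sym2 G.edgeSet × Plane) :=
  {q | ∃ e ∈ H, ∃ f ∈ K, e ≠ f ∧ q.1 = s(e, f) ∧ q.2 ∈ D.edge e ∩ D.edge f}

variable {m n : ℕ}

/-- The closed curve that represents the red cycle `R(j)`. -/
def redCurve (D : Drawing (cycleProduct m n)) (j : Fin n) : Set Plane :=
  (⋃ i : Fin m, {D.point (i, j)}) ∪ ⋃ e ∈ redEdges j, D.edge e

/-- All pairwise intersections of edges that involve an edge of the red cycle `R(j)`. -/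
def redCrossings (D : Drawing (cycleProduct m n)) (j : Fin n) :
    Set (Sym2 (cycleProduct m n).edgeSet × Plane) :=
  D.inter (redEdges j) Set.univ

/-- `b(D, j)` is defined and equal to `b`: the least `b` in `ℤ_n = {0, …, n - 1}` such that
`R(j - b)` is a red cycle other than `R(j)` that does not intersect `R(j)`. -/
def IsB (D : Drawing (cycleProduct m n)) (j b : Fin n) : Prop :=
  IsLeast {b : Fin n | j - b ≠ j ∧ D.inter (redEdges (j - b)) (redEdges j) = ∅} b

/-- `a(D, j)` is defined and equal to `a`, where `b = b(D, j)`: the least `a` in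
`ℤ_n = {0, …, n - 1}` such that `R(j + a)` is none of `R(j - b), …, R(j)` and intersects none
of them. -/
def IsA (D : Drawing (cycleProduct m n)) (j b a : Fin n) : Prop :=
  IsLeast {a : Fin n | ∀ c : Fin n, c ≤ b →
    j - c ≠ j + a ∧ D.inter (redEdges (j - c)) (redEdges (j + a)) = ∅} a

/-- For every `j`, both `b(D, j)` and `a(D, j)` are defined, and their sum, as integers, is less
than `n / 2`. -/
def Relaxed (D : Drawing (cycleProduct m n)) : Prop :=
  ∀ j : Fin n, ∃ b a : Fin n, D.IsB j b ∧ D.IsA j b a ∧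
    ((a : ℕ) : ℝ) + ((b : ℕ) : ℝ) < (n : ℝ) / 2

/-- A drawing is robust if its red cycles are nonseparating and it is relaxed. -/
def Robust (D : Drawing (cycleProduct m n)) : Prop :=
  Nonseparating D.redCurve ∧ D.Relaxed

end Drawing

/-! Suppose that every red cycle has fewer than m crossings. If R(j) separated two other red cycles,
then each of the m blue cycles, minus its vertex on R(j) and the two edges there, would be a
connected set meeting both, hence would intersect R(j): m crossings
(`le_encard_redCrossings_of_separates`). For relaxedness, red cycles that intersect do so at least
twice (`nontrivial_inter`), so each intersects at most d = ⌊(m-1)/2⌋ others. The pigeonhole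
principle then gives b ≤ d+1 and a ≤ (b+1)d+1, so a+b ≤ (d+1)(d+2) < n/2 (`exists_isLeast_sub_add`).
The topological core is that a single crossing cannot be the only common point of two closed curves
(`IsCrossing.not_inter_subset`). Straighten the crossing to the coordinate axes. The second curve
without the crossing joins i/2 to -i/2 off the first curve C, so (z - i/2)/(z + i/2) has a
continuous logarithm on C. Its increment from -1/2 to 1/2 is πi along the real segment, but -πi when
computed on C without the origin (`half_not_joined`). -/

/-! ### Closed curves with a single crossing, via continuous logarithms -/

open Complex Set Topology in
/-- On a preconnected set, two continuous logarithms of the same function differ by a constant. -/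
theorem IsPreconnected.sub_eq_sub_of_exp_eq {S : Set ℂ} (hS : IsPreconnected S) {f g : ℂ → ℂ}
    (hf : ContinuousOn f S) (hg : ContinuousOn g S) {c : ℂ} (h : ∀ z ∈ S, exp (f z) = c * exp (g z))
    {x y : ℂ} (hx : x ∈ S) (hy : y ∈ S) : f x - g x = f y - g y := by
  -- A local statement suffices: values of `f - g` differ by multiples of 2πi, so nearby ones agree.
  refine hS.induction₂ (fun x y => f x - g x = f y - g y) (fun x hx => ?_)
    (fun _ _ _ _ _ _ => Eq.trans) (fun _ _ _ _ => Eq.symm) hx hy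
  have hc : ContinuousWithinAt (fun y => f y - g y) S x := (hf.sub hg) x hx
  have hball := hc (Metric.ball_mem_nhds _ Real.two_pi_pos)
  filter_upwards [hball, self_mem_nhdsWithin] with y hy hyS
  have hexp : exp (f y - g y) = exp (f x - g x) := by
    rw [exp_sub, exp_sub, h y hyS, h x hx, mul_div_cancel_right₀ _ (exp_ne_zero _),
      mul_div_cancel_right₀ _ (exp_ne_zero _)]
  obtain ⟨k, hk⟩ := exp_eq_exp_iff_exists_int.1 hexp
  have hk' : (f y - g y) - (f x - g x) = k * (2 * Real.pi * Complex.I) := by rw [hk]; ring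
  have hy' : ‖(f y - g y) - (f x - g x)‖ < 2 * Real.pi := by
    simpa [dist_eq_norm] using hy
  rw [hk'] at hy'
  have hn : ‖(k : ℂ) * (2 * Real.pi * Complex.I)‖ = |(k : ℝ)| * (2 * Real.pi) := by
    simp [abs_of_pos Real.pi_pos]
  rw [hn] at hy'
  have hk1 : |(k : ℝ)| < 1 := by
    have := Real.two_pi_pos
    nlinarith
  have hk0 : k = 0 := by
    rw [← Int.abs_lt_one_iff]; exact_mod_cast hk1
  rw [hk, hk0]; simp

open Complex Set Topology in
/-- If two points lie in the same part of the complement of a closed set `C`, then the quotient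
of the vectors to them has a continuous logarithm on `C`. -/
theorem exists_continuousOn_log_div {C Q : Set ℂ} (hC : IsClosed C) (hQ : IsPreconnected Q)
    (hQC : Disjoint Q C) {p p' : ℂ} (hp : p ∈ Q) (hp' : p' ∈ Q) :
    ∃ f : ℂ → ℂ, ContinuousOn f C ∧ ∀ z ∈ C, exp (f z) = (z - p') / (z - p) := by
  have hne : ∀ q ∈ Q, ∀ z ∈ C, z - q ≠ 0 := fun q hq z hz h =>
    hQC.ne_of_mem hq hz (sub_eq_zero.1 h).symm
  -- Logarithms can be added and negated, so only p' close to p matters. There the quotient lies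
  -- within distance 1 of 1, and the principal branch serves.
  refine hQ.induction₂
    (fun p p' => ∃ f : ℂ → ℂ, ContinuousOn f C ∧ ∀ z ∈ C, exp (f z) = (z - p') / (z - p))
    (fun p hp => ?_) ?_ ?_ hp hp'
  · obtain ⟨r, hr, hrC⟩ := Metric.isOpen_iff.1 hC.isOpen_compl p (hQC.notMem_of_mem_left hp)
    filter_upwards [mem_nhdsWithin_of_mem_nhds (Metric.ball_mem_nhds p hr), self_mem_nhdsWithin]
      with p' hp' hpQ
    have hslit : ∀ z ∈ C, (z - p') / (z - p) ∈ slitPlane := by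
      intro z hz
      have h0 := hne p hp z hz
      have hzr : r ≤ ‖z - p‖ := by
        by_contra! hlt
        exact hrC (by simpa [dist_eq_norm] using hlt) hz
      have he : (z - p') / (z - p) = 1 + (p - p') / (z - p) := by field_simp; ring
      rw [he]
      apply mem_slitPlane_of_norm_lt_one
      rw [norm_div, div_lt_one (norm_pos_iff.2 h0)]
      refine lt_of_lt_of_le ?_ hzr
      rw [norm_sub_rev, ← dist_eq_norm]; exact hp'
    refine ⟨fun z => log ((z - p') / (z - p)), ?_, fun z hz => exp_log ?_⟩
    · refine ContinuousOn.clog (ContinuousOn.div (by fun_prop) (by fun_prop) (hne p hp)) hslit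
    · exact slitPlane_ne_zero (hslit z hz)
  · rintro a b c ha hb hc ⟨f, hf, hf'⟩ ⟨g, hg, hg'⟩
    refine ⟨fun z => f z + g z, hf.add hg, fun z hz => ?_⟩
    have := hne a ha z hz
    have := hne b hb z hz
    rw [exp_add, hf' z hz, hg' z hz]
    field_simp
  · rintro a b ha hb ⟨f, hf, hf'⟩
    refine ⟨fun z => - f z, hf.neg, fun z hz => ?_⟩
    rw [exp_neg, hf' z hz, inv_div]

open Complex Set Topology in
/-- A closed set that is the real axis in the unit disk and is connected off the origin separates the
points `i / 2` and `-i / 2`. -/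
theorem half_not_joined {C Q : Set ℂ} (hC : IsClosed C)
    (hC0 : ∀ z : ℂ, ‖z‖ < 1 → (z ∈ C ↔ z.im = 0)) (hconn : IsPreconnected (C \ {0}))
    (hQ : IsPreconnected Q) (hQC : Disjoint Q C) (hp : Complex.I / 2 ∈ Q) (hp' : -(Complex.I / 2) ∈ Q) : False := by
  obtain ⟨f, hf, hf'⟩ := exists_continuousOn_log_div hC hQ hQC hp' hp
  have hne : ∀ z ∈ C, z - Complex.I / 2 ≠ 0 := fun z hz h =>
    hQC.ne_of_mem hp hz (sub_eq_zero.1 h).symm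
  have hne' : ∀ z ∈ C, z - -(Complex.I / 2) ≠ 0 := fun z hz h =>
    hQC.ne_of_mem hp' hz (sub_eq_zero.1 h).symm
  set q : ℂ → ℂ := fun z => (z - Complex.I / 2) / (z - -(Complex.I / 2)) with hq
  have hqc : ContinuousOn q C := ContinuousOn.div (by fun_prop) (by fun_prop) hne'
  have hqne : ∀ z ∈ C, q z ≠ 0 := fun z hz => div_ne_zero (hne z hz) (hne' z hz)
  have hsq : ∀ z ∈ C, 0 < normSq (z - -(Complex.I / 2)) := fun z hz => normSq_pos.2 (hne' z hz)
  -- Up to a positive factor these are the parts of `q z`: it is real only on the imaginary axis,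
  -- and then nonpositive only between -i/2 and i/2.
  have hre : ∀ z ∈ C,
      (q z).re * normSq (z - -(Complex.I / 2)) = z.re ^ 2 + z.im ^ 2 - 1 / 4 := by
    intro z hz
    rw [hq, div_re, ← add_div, div_mul_cancel₀ _ (hsq z hz).ne']
    simp
    ring
  have him : ∀ z ∈ C, (q z).im * normSq (z - -(Complex.I / 2)) = - z.re := by
    intro z hz
    rw [hq, div_im, ← sub_div, div_mul_cancel₀ _ (hsq z hz).ne']
    simp
    ring
  -- off the origin, `q` avoids the negative real axis
  have hs1 : ∀ z ∈ C \ {0}, q z ∈ slitPlane := by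
    rintro z ⟨hz, hz0⟩
    by_contra hns
    rw [mem_slitPlane_iff, not_or, not_lt, not_not] at hns
    have h1 := hre z hz
    have h2 := him z hz
    rw [hns.2, zero_mul] at h2
    have hz1 : z.re = 0 := by linarith
    have h3 : z.im ^ 2 ≤ 1 / 4 := by
      have := mul_nonpos_of_nonpos_of_nonneg hns.1 (hsq z hz).le
      rw [hz1] at h1
      nlinarith
    have hlt : ‖z‖ < 1 := by
      have : ‖z‖ ≤ |z.re| + |z.im| := norm_le_abs_re_add_abs_im z
      have h4 : |z.im| ≤ 1 / 2 := abs_le_of_sq_le_sq (by norm_num; linarith) (by norm_num)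
      rw [hz1, abs_zero] at this
      linarith
    exact hz0 (Complex.ext hz1 ((hC0 z hlt).1 hz))
  -- the real segment
  set M : Set ℂ := segment ℝ (-(1 / 2)) (1 / 2) with hM
  have hMim : ∀ z ∈ M, z.im = 0 ∧ |z.re| ≤ 1 / 2 := by
    rintro z ⟨a, b, ha, hb, hab, rfl⟩
    constructor
    · simp
    · simp [abs_le]; constructor <;> linarith
  have hMC : M ⊆ C := by
    intro z hz
    obtain ⟨h1, h2⟩ := hMim z hz
    refine (hC0 z ?_).2 h1
    have : ‖z‖ ≤ |z.re| + |z.im| := norm_le_abs_re_add_abs_im z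
    rw [h1, abs_zero] at this
    linarith
  -- On the segment, `q` is real only at 0, where it is negative.
  have hs2 : ∀ z ∈ M, -q z ∈ slitPlane := by
    intro z hz
    have h1 := hre z (hMC hz)
    have h2 := him z (hMC hz)
    have h3 := hsq z (hMC hz)
    obtain ⟨h4, h5⟩ := hMim z hz
    by_cases h0 : z.re = 0
    · left
      rw [h4, h0] at h1
      simp only [neg_re]
      nlinarith
    · right
      intro h
      rw [neg_im, neg_eq_zero] at h
      rw [h] at h2
      exact h0 (by linarith)
  have hr : (1 / 2 : ℂ) ∈ M := right_mem_segment _ _ _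
  have hl : (-(1 / 2) : ℂ) ∈ M := left_mem_segment _ _ _
  -- Both `e1` and `e2` compute the increment of `f` from -1/2 to 1/2, with log q and log(-q)
  -- respectively; the results are -πi and πi.
  have e1 := hconn.sub_eq_sub_of_exp_eq (c := 1) (g := fun z => log (q z)) (hf.mono sdiff_subset)
    ((hqc.mono sdiff_subset).clog hs1)
    (fun z hz => by rw [hf' z hz.1, exp_log (hqne z hz.1), one_mul])
    (x := 1 / 2) (y := -(1 / 2)) ⟨hMC hr, by norm_num⟩ ⟨hMC hl, by norm_num⟩
  have e2 := (convex_segment (𝕜 := ℝ) (-(1 / 2) : ℂ) (1 / 2)).isPreconnected.sub_eq_sub_of_exp_eq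
    (c := -1) (g := fun z => log (- q z)) (hf.mono hMC)
    ((hqc.mono hMC).neg.clog hs2)
    (fun z hz => by
      rw [hf' z (hMC hz), exp_log (neg_ne_zero.2 (hqne z (hMC hz))), neg_one_mul, neg_neg]) hr hl
  have q1 : q (1 / 2) = -Complex.I := by
    rw [hq]
    have : (1 / 2 - -(Complex.I / 2) : ℂ) ≠ 0 := hne' _ (hMC hr)
    simp only
    rw [div_eq_iff this]
    linear_combination (1 / 2 : ℂ) * I_sq
  have q2 : q (-(1 / 2)) = Complex.I := by
    rw [hq]
    have : (-(1 / 2) - -(Complex.I / 2) : ℂ) ≠ 0 := hne' _ (hMC hl)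
    simp only
    rw [div_eq_iff this]
    linear_combination (-1 / 2 : ℂ) * I_sq
  simp only [q1, q2, neg_neg, log_I, log_neg_I] at e1 e2
  have h3 : (Real.pi : ℂ) * Complex.I = 0 := by linear_combination (e1 - e2) / 2
  simp [Real.pi_ne_zero] at h3

open Set in
/-- A closed curve minus a point through which it passes once is connected. -/
theorem isPreconnected_diff_singleton {X : Type*} [TopologicalSpace X] {γ : C(I, X)} {A : Set X}
    {x : X} (hA : IsPreconnected A) (h0 : γ 0 ∈ A) (h1 : γ 1 ∈ A) (hx : x ∉ A)
    (h : ∃! t, t ∈ Ioo (0 : I) 1 ∧ γ t = x) : IsPreconnected ((range γ ∪ A) \ {x}) := by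
  obtain ⟨t, ⟨ht, htx⟩, huniq⟩ := h
  have huniq' : ∀ s, γ s = x → s = t := by
    intro s hs
    refine huniq s ⟨⟨?_, ?_⟩, hs⟩
    · exact lt_of_le_of_ne' s.2.1 (by rintro rfl; exact hx (hs ▸ h0))
    · exact lt_of_le_of_ne s.2.2 (by rintro rfl; exact hx (hs ▸ h1))
  -- Removing the only passage through x leaves two pieces of the arc, each attached to A at an end
  -- point.
  have he : (range γ ∪ A) \ {x} = γ '' Ico 0 t ∪ A ∪ γ '' Ioc t 1 := by
    ext z
    constructor
    · rintro ⟨⟨s, rfl⟩ | hz, hzx⟩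
      · rcases lt_trichotomy s t with hs | rfl | hs
        · exact Or.inl (Or.inl ⟨s, ⟨s.2.1, hs⟩, rfl⟩)
        · exact absurd htx hzx
        · exact Or.inr ⟨s, ⟨hs, s.2.2⟩, rfl⟩
      · exact Or.inl (Or.inr hz)
    · rintro ((⟨s, hs, rfl⟩ | hz) | ⟨s, hs, rfl⟩)
      · exact ⟨Or.inl ⟨s, rfl⟩, fun hsx => hs.2.ne (huniq' s hsx)⟩
      · exact ⟨Or.inr hz, fun hzx => hx (hzx ▸ hz)⟩
      · exact ⟨Or.inl ⟨s, rfl⟩, fun hsx => hs.1.ne' (huniq' s hsx)⟩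
  rw [he]
  refine IsPreconnected.union (γ 1) (Or.inr h1) ⟨1, ⟨ht.2, le_rfl⟩, rfl⟩
    (IsPreconnected.union (γ 0) ⟨0, ⟨le_rfl, ht.1⟩, rfl⟩ h0 ?_ hA) ?_
  · exact ordConnected_Ico.isPreconnected.image _ γ.continuous.continuousOn
  · exact ordConnected_Ioc.isPreconnected.image _ γ.continuous.continuousOn

open Set in
theorem range_eq_openArc_union (γ : C(I, Plane)) : range γ = openArc γ ∪ {γ 0, γ 1} := by
  ext z
  constructor
  · rintro ⟨s, rfl⟩
    by_cases h0 : s = 0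
    · right; left; rw [h0]
    by_cases h1 : s = 1
    · right; right; rw [h1]; rfl
    exact Or.inl ⟨s, ⟨lt_of_le_of_ne' s.2.1 h0, lt_of_le_of_ne s.2.2 h1⟩, rfl⟩
  · rintro (⟨s, -, rfl⟩ | rfl | rfl) <;> exact ⟨_, rfl⟩

open Set in
/-- Two closed curves cannot have a single crossing as their only common point. -/
theorem IsCrossing.not_inter_subset {γ δ : C(I, Plane)} {x : Plane} (h : IsCrossing γ δ x)
    {A B : Set Plane} (hAc : IsClosed A) (hA : IsPreconnected A) (hA0 : γ 0 ∈ A) (hA1 : γ 1 ∈ A)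
    (hxA : x ∉ A) (hBc : IsClosed B) (hB : IsPreconnected B) (hB0 : δ 0 ∈ B) (hB1 : δ 1 ∈ B)
    (hxB : x ∉ B) : ¬ (range γ ∪ A) ∩ (range δ ∪ B) ⊆ {x} := by
  intro hsub
  obtain ⟨hγ, hδ, Φ, hΦ0, hΦ⟩ := h
  -- A small disc around x misses A and B. Scaling it by a real factor to the unit disc preserves
  -- the axes.
  have hopen : IsOpen (Φ ⁻¹' (A ∪ B)ᶜ) := (hAc.union hBc).isOpen_compl.preimage Φ.continuous
  obtain ⟨r, hr, hrA⟩ := Metric.isOpen_iff.1 hopen 0 (by simp [hΦ0, hxA, hxB])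
  set ρ : ℝ := min r 1 with hρ
  have hρ0 : 0 < ρ := lt_min hr one_pos
  have hρne : (ρ : ℂ) ≠ 0 := by exact_mod_cast hρ0.ne'
  set Ψ : Plane ≃ₜ Plane := (Homeomorph.mulLeft₀ (ρ : ℂ) hρne).trans Φ with hΨ
  have hΨz : ∀ z, Ψ z = Φ (ρ * z) := fun z => rfl
  have hΨ0 : Ψ 0 = x := by rw [hΨz, mul_zero, hΦ0]
  have hlt : ∀ z : ℂ, ‖z‖ < 1 → ‖(ρ : ℂ) * z‖ < ρ := fun z hz => by
    rw [norm_mul, Complex.norm_real, Real.norm_of_nonneg hρ0.le]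
    exact mul_lt_of_lt_one_right hρ0 hz
  have hnot : ∀ z : ℂ, ‖z‖ < 1 → Ψ z ∉ A ∧ Ψ z ∉ B := fun z hz => by
    have : (ρ : ℂ) * z ∈ Metric.ball (0 : ℂ) r := by
      rw [mem_ball_zero_iff]
      exact (hlt z hz).trans_le (min_le_left _ _)
    have := hrA this
    simpa [hΨz, not_or] using this
  have hγ' : ∀ z : ℂ, ‖z‖ < 1 → (Ψ z ∈ range γ ∪ A ↔ z.im = 0) := fun z hz => by
    have h1 := (hΦ _ ((hlt z hz).trans_le (min_le_right _ _))).1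
    rw [← hΨz] at h1
    have h2 := (hnot z hz).1
    have h3 : Ψ z ∉ ({γ 0, γ 1} : Set Plane) := by
      rintro (h | h) <;> exact h2 (by rw [h]; assumption)
    rw [range_eq_openArc_union]
    simp only [mem_union, h2, h3, or_false, h1]
    simp [hρ0.ne']
  have hδ' : ∀ z : ℂ, ‖z‖ < 1 → (Ψ z ∈ range δ ∪ B ↔ z.re = 0) := fun z hz => by
    have h1 := (hΦ _ ((hlt z hz).trans_le (min_le_right _ _))).2
    rw [← hΨz] at h1
    have h2 := (hnot z hz).2
    have h3 : Ψ z ∉ ({δ 0, δ 1} : Set Plane) := by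
      rintro (h | h) <;> exact h2 (by rw [h]; assumption)
    rw [range_eq_openArc_union]
    simp only [mem_union, h2, h3, or_false, h1]
    simp [hρ0.ne']
  have hpre : ∀ S : Set Plane, Ψ ⁻¹' (S \ {x}) = Ψ ⁻¹' S \ {0} := fun S => by
    ext z
    rw [← hΨ0]
    simp
  refine half_not_joined (C := Ψ ⁻¹' (range γ ∪ A)) (Q := Ψ ⁻¹' (range δ ∪ B) \ {0}) ?_ hγ' ?_ ?_ ?_
    ?_ ?_
  · exact ((isCompact_range γ.continuous).isClosed.union hAc).preimage Ψ.continuous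
  · rw [← hpre, Homeomorph.isPreconnected_preimage]
    exact isPreconnected_diff_singleton hA hA0 hA1 hxA hγ
  · rw [← hpre, Homeomorph.isPreconnected_preimage]
    exact isPreconnected_diff_singleton hB hB0 hB1 hxB hδ
  · rw [← hpre, Set.disjoint_left]
    exact fun z hz hz' => hz.2 (hsub ⟨hz', hz.1⟩)
  · exact ⟨(hδ' _ (by norm_num)).2 (by simp), by simp⟩
  · exact ⟨(hδ' _ (by norm_num)).2 (by simp), by simp⟩

/-! ### Closures of edges -/

namespace Drawing

section General

variable {V : Type*} {G : SimpleGraph V} (D : Drawing G)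

open Set in
theorem mem_range_arc_iff {e : G.edgeSet} {z : Plane} :
    z ∈ range (D.arc e) ↔ z ∈ D.edge e ∨ ∃ v ∈ e.1, z = D.point v := by
  have key : z ∈ ({D.arc e 0, D.arc e 1} : Set Plane) ↔ ∃ v ∈ e.1, z = D.point v := by
    have h1 : z ∈ ({D.arc e 0, D.arc e 1} : Set Plane) ↔ z ∈ s(D.arc e 0, D.arc e 1) := by simp
    rw [h1, D.arc_ends, Sym2.mem_map]
    simp only [eq_comm]
  rw [range_eq_openArc_union, mem_union, key]
  rfl

open Set in
theorem point_mem_range_arc {e : G.edgeSet} {v : V} (h : v ∈ e.1) :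
    D.point v ∈ range (D.arc e) :=
  D.mem_range_arc_iff.2 (Or.inr ⟨v, h, rfl⟩)

theorem exists_arc_zero (e : G.edgeSet) : ∃ v ∈ e.1, D.arc e 0 = D.point v := by
  have h : D.arc e 0 ∈ s(D.arc e 0, D.arc e 1) := by simp
  rw [D.arc_ends, Sym2.mem_map] at h
  simpa only [eq_comm] using h

theorem exists_arc_one (e : G.edgeSet) : ∃ v ∈ e.1, D.arc e 1 = D.point v := by
  have h : D.arc e 1 ∈ s(D.arc e 0, D.arc e 1) := by simp
  rw [D.arc_ends, Sym2.mem_map] at h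
  simpa only [eq_comm] using h

open Set in
/-- A common point of the closures of two edges without common end is an intersection of the
edges. -/
theorem mem_edge_inter_edge {e f : G.edgeSet} (h : ∀ v ∈ e.1, v ∉ f.1) {z : Plane}
    (he : z ∈ range (D.arc e)) (hf : z ∈ range (D.arc f)) : z ∈ D.edge e ∩ D.edge f := by
  rcases D.mem_range_arc_iff.1 he with he | ⟨v, hv, rfl⟩ <;>
    rcases D.mem_range_arc_iff.1 hf with hf | ⟨w, hw, hw'⟩
  · exact ⟨he, hf⟩
  · exact absurd (hw' ▸ he) (D.vertex_notMem_arc e w)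
  · exact absurd hf (D.vertex_notMem_arc f v)
  · exact absurd (D.point_injective hw' ▸ hw) (h v hv)

-- Consecutive arcs of a walk share a vertex. This serves both for red cycles minus an edge and for
-- blue paths.
open Set in
theorem isPreconnected_biUnion_range_arc {e : ℕ → G.edgeSet} {v : ℕ → V}
    (he : ∀ c, (e c).1 = s(v c, v (c + 1))) (a b : ℕ) :
    IsPreconnected (⋃ c ∈ Icc a b, range (D.arc (e c))) := by
  refine IsPreconnected.biUnion_of_chain ordConnected_Icc
    (fun c _ => isPreconnected_range (D.arc (e c)).continuous) fun c _ _ => ⟨D.point (v (c + 1)), ?_⟩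
  constructor <;> apply point_mem_range_arc <;> simp [he]

open Set in
theorem isClosed_biUnion_range_arc (e : ℕ → G.edgeSet) (a b : ℕ) :
    IsClosed (⋃ c ∈ Icc a b, range (D.arc (e c))) :=
  (finite_Icc a b).isClosed_biUnion fun c _ => (isCompact_range (D.arc (e c)).continuous).isClosed

theorem inter_eq_empty_comm {H K : Set G.edgeSet} : D.inter H K = ∅ ↔ D.inter K H = ∅ := by
  have key : ∀ H K : Set G.edgeSet, D.inter H K ⊆ D.inter K H := by
    rintro H K q ⟨e, he, f, hf, hne, hq, hx⟩
    exact ⟨f, hf, e, he, hne.symm, hq.trans Sym2.eq_swap, hx.symm⟩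
  rw [(key H K).antisymm (key K H)]

end General

open scoped Fin.CommRing

/-! ### The edges of red and blue cycles -/

variable {m n : ℕ}

/-- The edge of the red cycle `R(j)` that joins `(i, j)` and `(i + 1, j)`. -/
def redEdge (i : Fin (m + 2)) (j : Fin (n + 2)) : (cycleProduct (m + 2) (n + 2)).edgeSet :=
  ⟨s((i, j), (i + 1, j)), by simp [SimpleGraph.boxProd_adj, SimpleGraph.cycleGraph_adj]⟩

/-- The edge that joins `(i, j)` and `(i, j + 1)`. -/
def blueEdge (i : Fin (m + 2)) (j : Fin (n + 2)) : (cycleProduct (m + 2) (n + 2)).edgeSet :=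
  ⟨s((i, j), (i, j + 1)), by simp [SimpleGraph.boxProd_adj, SimpleGraph.cycleGraph_adj]⟩

theorem redEdge_mem (i : Fin (m + 2)) (j : Fin (n + 2)) : redEdge i j ∈ redEdges j := by
  intro v hv
  rcases Sym2.mem_iff.1 hv with rfl | rfl <;> rfl

theorem exists_eq_redEdge {j : Fin (n + 2)} {e : (cycleProduct (m + 2) (n + 2)).edgeSet}
    (he : e ∈ redEdges j) : ∃ i, e = redEdge i j := by
  obtain ⟨e, hadj⟩ := e
  induction e with | _ v w
  obtain ⟨a, b⟩ := v
  obtain ⟨c, d⟩ := w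
  have hb : b = j := he (a, b) (by simp)
  have hd : d = j := he (c, d) (by simp)
  subst hb hd
  simp only [SimpleGraph.mem_edgeSet, SimpleGraph.boxProd_adj_left, SimpleGraph.cycleGraph_adj]
    at hadj
  rcases hadj with h | h
  · obtain rfl : a = c + 1 := by rw [← h]; abel
    exact ⟨c, Subtype.ext Sym2.eq_swap⟩
  · obtain rfl : c = a + 1 := by rw [← h]; abel
    exact ⟨a, rfl⟩

theorem eq_of_mem_redEdges {j k : Fin n} {e : (cycleProduct m n).edgeSet}
    (hj : e ∈ redEdges j) (hk : e ∈ redEdges k) : j = k := by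
  obtain ⟨e, he⟩ := e
  induction e with | _ v w
  rw [← hj v (by simp), ← hk v (by simp)]

theorem add_natCast_ne_self (i : Fin (m + 2)) {c : ℕ} (h1 : 1 ≤ c) (h2 : c < m + 2) :
    i + (c : Fin (m + 2)) ≠ i := by
  rw [Ne, add_eq_left, Fin.natCast_eq_zero]
  exact Nat.not_dvd_of_pos_of_lt h1 h2

theorem add_natCast_val_sub (i k : Fin (m + 2)) : i + (((k - i).val : ℕ) : Fin (m + 2)) = k := by
  rw [Fin.cast_val_eq_self]; abel

/-- The cycle has length at least 3: the same edge traversed backwards would force i + 2 = i. -/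
theorem redEdge_add_ne (hm : 1 ≤ m) (i : Fin (m + 2)) (j : Fin (n + 2)) {c : ℕ} (h1 : 1 ≤ c)
    (h2 : c < m + 2) : redEdge (i + (c : Fin (m + 2))) j ≠ redEdge i j := by
  intro h
  have h' := Subtype.ext_iff.1 h
  simp only [redEdge, Sym2.eq_iff, Prod.mk.injEq, and_true] at h'
  rcases h' with ⟨h', -⟩ | ⟨h', h''⟩
  · exact add_natCast_ne_self i h1 h2 h'
  · rw [h'] at h''
    refine add_natCast_ne_self i (c := 2) (by norm_num) (by omega) ?_
    rw [← h'']; push_cast; nth_rewrite 1 [h'']; rw [add_assoc, one_add_one_eq_two]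

variable (D : Drawing (cycleProduct (m + 2) (n + 2)))

/-- The closures of the edges of `R(j)` other than `redEdge i j`. -/
def redRest (i : Fin (m + 2)) (j : Fin (n + 2)) : Set Plane :=
  ⋃ c ∈ Set.Icc 1 (m + 1), Set.range (D.arc (redEdge (i + (c : Fin (m + 2))) j))

theorem isPreconnected_redRest (i : Fin (m + 2)) (j : Fin (n + 2)) :
    IsPreconnected (D.redRest i j) :=
  D.isPreconnected_biUnion_range_arc (e := fun c : ℕ => redEdge (i + (c : Fin (m + 2))) j)
    (v := fun c : ℕ => (i + (c : Fin (m + 2)), j))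
    (fun c => by simp only [redEdge, Nat.cast_succ, add_assoc]) 1 (m + 1)

theorem isClosed_redRest (i : Fin (m + 2)) (j : Fin (n + 2)) : IsClosed (D.redRest i j) :=
  D.isClosed_biUnion_range_arc (fun c : ℕ => redEdge (i + (c : Fin (m + 2))) j) 1 (m + 1)

theorem point_mem_redRest {i : Fin (m + 2)} {j : Fin (n + 2)} {v : Fin (m + 2) × Fin (n + 2)}
    (hv : v ∈ (redEdge i j).1) : D.point v ∈ D.redRest i j := by
  simp only [redEdge, Sym2.mem_iff] at hv
  rcases hv with rfl | rfl
  · refine Set.mem_biUnion (x := m + 1) ⟨by omega, le_rfl⟩ (D.point_mem_range_arc ?_)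
    have : i + ((m + 1 : ℕ) : Fin (m + 2)) + 1 = i := by
      rw [add_assoc, ← Nat.cast_succ, Fin.natCast_self, add_zero]
    simp only [redEdge, this, Sym2.mem_iff, or_true]
  · refine Set.mem_biUnion (x := 1) ⟨le_rfl, by omega⟩ (D.point_mem_range_arc ?_)
    simp [redEdge]

theorem exists_mem_redEdges_of_mem {i : Fin (m + 2)} {j : Fin (n + 2)} {z : Plane}
    (hz : z ∈ Set.range (D.arc (redEdge i j)) ∪ D.redRest i j) :
    ∃ e ∈ redEdges j, z ∈ Set.range (D.arc e) := by
  rcases hz with hz | hz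
  · exact ⟨_, redEdge_mem i j, hz⟩
  · obtain ⟨c, -, hz⟩ := Set.mem_iUnion₂.1 hz
    exact ⟨_, redEdge_mem _ j, hz⟩

theorem exists_ne_of_mem_redRest (hm : 1 ≤ m) {i : Fin (m + 2)} {j : Fin (n + 2)} {z : Plane}
    (hz : z ∈ D.redRest i j) : ∃ e ∈ redEdges j, e ≠ redEdge i j ∧ z ∈ Set.range (D.arc e) := by
  obtain ⟨c, hc, hz⟩ := Set.mem_iUnion₂.1 hz
  exact ⟨_, redEdge_mem _ j, redEdge_add_ne hm i j hc.1 (Nat.lt_succ_of_le hc.2), hz⟩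

variable {D}

/-! ### Intersections between red cycles -/

/-- Two red cycles cannot intersect exactly once. -/
theorem AllIntersectionsCross.nontrivial_inter (hD : D.AllIntersectionsCross) (hm : 1 ≤ m)
    {j k : Fin (n + 2)} (hjk : j ≠ k) (h : D.inter (redEdges j) (redEdges k) ≠ ∅) :
    (D.inter (redEdges j) (redEdges k)).Nontrivial := by
  rw [← Set.not_subsingleton_iff]
  intro hsub
  obtain ⟨⟨q, x⟩, hq⟩ := Set.nonempty_iff_ne_empty.2 h
  obtain ⟨e, he, f, hf, hef, rfl, hx⟩ := id hq
  dsimp only at hx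
  have hvert : ∀ e' ∈ redEdges (m := m + 2) j, ∀ f' ∈ redEdges k, ∀ v ∈ e'.1, v ∉ f'.1 :=
    fun e' he' f' hf' v hv hv' => hjk ((he' v hv).symm.trans (hf' v hv'))
  have hne : ∀ e' ∈ redEdges (m := m + 2) j, ∀ f' ∈ redEdges k, e' ≠ f' := fun e' he' f' hf' h =>
    hjk (eq_of_mem_redEdges he' (h ▸ hf'))
  -- Members of `inter` record both the edges and the point, so uniqueness determines all three.
  -- Closures may replace open arcs since the two cycles share no vertex.
  have huniq : ∀ e' ∈ redEdges j, ∀ f' ∈ redEdges k, ∀ z, z ∈ Set.range (D.arc e') →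
      z ∈ Set.range (D.arc f') → e' = e ∧ f' = f ∧ z = x := by
    intro e' he' f' hf' z hz hz'
    have hmem : (s(e', f'), z) ∈ D.inter (redEdges j) (redEdges k) :=
      ⟨e', he', f', hf', hne e' he' f' hf', rfl,
        D.mem_edge_inter_edge (hvert e' he' f' hf') hz hz'⟩
    have heq := hsub hmem hq
    rw [Prod.mk.injEq, Sym2.eq_iff] at heq
    rcases heq with ⟨⟨h1, h2⟩ | ⟨h1, h2⟩, h3⟩
    · exact ⟨h1, h2, h3⟩
    · exact absurd h1 (hne _ he' _ hf)
  have hcross := hD e f hef x hx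
  obtain ⟨i, rfl⟩ := exists_eq_redEdge he
  obtain ⟨l, rfl⟩ := exists_eq_redEdge hf
  have hxe : x ∈ Set.range (D.arc (redEdge i j)) := D.mem_range_arc_iff.2 (Or.inl hx.1)
  have hxf : x ∈ Set.range (D.arc (redEdge l k)) := D.mem_range_arc_iff.2 (Or.inl hx.2)
  have h0 : ∀ (i : Fin (m + 2)) (j : Fin (n + 2)), D.arc (redEdge i j) 0 ∈ D.redRest i j := by
    intro i j
    obtain ⟨v, hv, hv'⟩ := D.exists_arc_zero (redEdge i j)
    exact hv' ▸ D.point_mem_redRest hv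
  have h1 : ∀ (i : Fin (m + 2)) (j : Fin (n + 2)), D.arc (redEdge i j) 1 ∈ D.redRest i j := by
    intro i j
    obtain ⟨v, hv, hv'⟩ := D.exists_arc_one (redEdge i j)
    exact hv' ▸ D.point_mem_redRest hv
  refine hcross.not_inter_subset (D.isClosed_redRest i j) (D.isPreconnected_redRest i j)
    (h0 i j) (h1 i j) ?_ (D.isClosed_redRest l k) (D.isPreconnected_redRest l k)
    (h0 l k) (h1 l k) ?_ ?_
  · intro hxr
    obtain ⟨e', he', hne', hz⟩ := D.exists_ne_of_mem_redRest hm hxr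
    exact hne' (huniq e' he' _ hf x hz hxf).1
  · intro hxr
    obtain ⟨f', hf', hne', hz⟩ := D.exists_ne_of_mem_redRest hm hxr
    exact hne' (huniq _ he f' hf' x hxe hz).2.1
  · rintro z ⟨hz, hz'⟩
    obtain ⟨e', he', hze⟩ := D.exists_mem_redEdges_of_mem hz
    obtain ⟨f', hf', hzf⟩ := D.exists_mem_redEdges_of_mem hz'
    exact (huniq e' he' f' hf' z hze hzf).2.2

open Classical in
/-- The red cycles other than `R(j)` that intersect `R(j)`. -/
noncomputable def redNeighbors (D : Drawing (cycleProduct (m + 2) (n + 2))) (j : Fin (n + 2)) :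
    Finset (Fin (n + 2)) :=
  Finset.univ.filter fun k => k ≠ j ∧ D.inter (redEdges k) (redEdges j) ≠ ∅

/-- A red cycle has at least two crossings with each red cycle that it intersects. -/
theorem AllIntersectionsCross.two_mul_card_redNeighbors_le (hD : D.AllIntersectionsCross)
    (hm : 1 ≤ m) (j : Fin (n + 2)) :
    ((2 * (D.redNeighbors j).card : ℕ) : ℕ∞) ≤ (D.redCrossings j).encard := by
  have h : ∀ k : D.redNeighbors j, ∃ q ∈ D.inter (redEdges j) (redEdges k.1),
      ∃ q' ∈ D.inter (redEdges j) (redEdges k.1), q ≠ q' := by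
    rintro ⟨k, hk⟩
    simp only [redNeighbors, Finset.mem_filter, Finset.mem_univ, true_and] at hk
    exact hD.nontrivial_inter hm hk.1.symm (fun h => hk.2 (D.inter_eq_empty_comm.1 h))
  choose q hq q' hq' hne using h
  have hj : ∀ k : D.redNeighbors j, j ≠ k.1 := by
    rintro ⟨k, hk⟩
    simp only [redNeighbors, Finset.mem_filter, Finset.mem_univ, true_and] at hk
    exact hk.1.symm
  let F : D.redNeighbors j × Bool → Sym2 (cycleProduct (m + 2) (n + 2)).edgeSet × Plane :=
    fun p => if p.2 then q p.1 else q' p.1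
  have hF : ∀ p, F p ∈ D.inter (redEdges j) (redEdges p.1.1) := by
    rintro ⟨k, _ | _⟩
    · exact hq' k
    · exact hq k
  -- The pair of edges determines k, so crossings with different neighbors differ.
  have hinj : Function.Injective F := by
    rintro ⟨k, b⟩ ⟨l, c⟩ hkl
    have hkl' : k = l := by
      obtain ⟨e, he, f, hf, hef, h1, -⟩ := hF (k, b)
      obtain ⟨e', he', f', hf', hef', h1', -⟩ := hF (l, c)
      rw [hkl, h1', Sym2.eq_iff] at h1
      rcases h1 with ⟨h2, h3⟩ | ⟨h2, h3⟩
      · exact Subtype.ext (eq_of_mem_redEdges hf (h3 ▸ hf'))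
      · exact absurd (eq_of_mem_redEdges he' (h2 ▸ hf)) (hj k)
    subst hkl'
    cases b <;> cases c <;> simp_all [F]
    exact absurd hkl.symm (hne k.1 k.2)
  have hsub : Set.range F ⊆ D.redCrossings j := by
    rintro _ ⟨p, rfl⟩
    obtain ⟨e, he, f, -, h⟩ := hF p
    exact ⟨e, he, f, trivial, h⟩
  refine le_trans (le_trans (le_of_eq ?_) hinj.encard_range) (Set.encard_le_encard hsub)
  simp [ENat.card_eq_coe_fintype_card, mul_comm]

/-! ### Separating red cycles -/

/-- If `R(j)` separates two further red cycles, then every cycle of the other direction intersects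
`R(j)`. -/
theorem exists_mem_inter_blueEdge {j k l : Fin (n + 2)} (hn : 1 ≤ n) (hjk : j ≠ k) (hjl : j ≠ l)
    (h : Separates (D.redCurve j) (D.redCurve k) (D.redCurve l)) (i : Fin (m + 2)) :
    ∃ e ∈ redEdges j, ∃ c, (D.edge e ∩ D.edge (blueEdge i c)).Nonempty := by
  by_contra! hcon
  -- The blue path from j+1 to j-1: omitting c = 0 and c = n+1 drops the two edges at (i, j).
  set P : Set Plane := ⋃ c ∈ Set.Icc 1 n, Set.range (D.arc (blueEdge i (j + (c : Fin (n + 2)))))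
    with hP
  have hconn : IsPreconnected P :=
    D.isPreconnected_biUnion_range_arc (e := fun c : ℕ => blueEdge i (j + (c : Fin (n + 2))))
      (v := fun c : ℕ => (i, j + (c : Fin (n + 2))))
      (fun c => by simp only [blueEdge, Nat.cast_succ, add_assoc]) 1 n
  have hmem : ∀ k, j ≠ k → D.point (i, k) ∈ P := by
    intro k hk
    have hc := add_natCast_val_sub j k
    have hc0 : (k - j).val ≠ 0 := by
      intro h0
      rw [h0, Nat.cast_zero, add_zero] at hc
      exact hk hc
    have hlt := (k - j).isLt
    set c := (k - j).val
    by_cases hcn : c ≤ n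
    · refine Set.mem_biUnion (x := c) ⟨Nat.one_le_iff_ne_zero.2 hc0, hcn⟩
        (D.point_mem_range_arc ?_)
      simp only [blueEdge, hc, Sym2.mem_iff, true_or]
    -- The vertex at j-1 is only the far end of the last edge of the path.
    · have hcn' : c = n + 1 := by omega
      refine Set.mem_biUnion (x := n) ⟨hn, le_rfl⟩ (D.point_mem_range_arc ?_)
      rw [hcn', Nat.cast_succ, ← add_assoc] at hc
      simp only [blueEdge, hc, Sym2.mem_iff, or_true]
  have hsub : P ⊆ (D.redCurve j)ᶜ := by
    intro z hz hzj
    obtain ⟨c, hc, hz⟩ := Set.mem_iUnion₂.1 hz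
    have hv : ∀ v ∈ (blueEdge i (j + (c : Fin (n + 2)))).1, v.2 ≠ j := by
      intro v hv
      simp only [blueEdge, Sym2.mem_iff] at hv
      rcases hv with rfl | rfl
      · exact add_natCast_ne_self j hc.1 (by have := hc.2; omega)
      · dsimp only
        rw [add_assoc, ← Nat.cast_succ]
        exact add_natCast_ne_self j (by omega) (by have := hc.2; omega)
    rcases hzj with hzj | hzj
    · obtain ⟨i', hi'⟩ := Set.mem_iUnion.1 hzj
      rw [Set.mem_singleton_iff] at hi'
      subst hi'
      rcases D.mem_range_arc_iff.1 hz with hz | ⟨v, hv1, hv2⟩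
      · exact D.vertex_notMem_arc _ _ hz
      · exact hv v hv1 (by rw [← D.point_injective hv2])
    · obtain ⟨e, he, hze⟩ := Set.mem_iUnion₂.1 hzj
      have := D.mem_edge_inter_edge (e := e) (fun v hv1 hv2 => hv v hv2 (he v hv1))
        (D.mem_range_arc_iff.2 (Or.inl hze)) hz
      rw [hcon e he] at this
      exact this
  have hin : ∀ k, D.point (i, k) ∈ D.redCurve k := fun k =>
    Or.inl (Set.mem_iUnion.2 ⟨i, rfl⟩)
  have hcomp := hconn.subset_connectedComponentIn (hmem k hjk) hsub
  exact h _ (hsub (hmem k hjk)) ⟨⟨_, hcomp (hmem k hjk), hin k⟩, ⟨_, hcomp (hmem l hjl), hin l⟩⟩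

/-- Different blue cycles have no common edge, so each contributes its own crossing. -/
theorem le_encard_redCrossings_of_separates {j k l : Fin (n + 2)} (hn : 1 ≤ n) (hjk : j ≠ k)
    (hjl : j ≠ l) (h : Separates (D.redCurve j) (D.redCurve k) (D.redCurve l)) :
    ((m + 2 : ℕ) : ℕ∞) ≤ (D.redCrossings j).encard := by
  have hblue : ∀ (i : Fin (m + 2)) c, blueEdge i c ∉ redEdges (m := m + 2) j := by
    intro i c hc
    have h1 := hc (i, c) (by simp [blueEdge])
    have h2 := hc (i, c + 1) (by simp [blueEdge])
    have h3 : c + 1 = c := h2.trans h1.symm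
    simp at h3
  choose e he c x hx using exists_mem_inter_blueEdge hn hjk hjl h
  let F : Fin (m + 2) → Sym2 (cycleProduct (m + 2) (n + 2)).edgeSet × Plane :=
    fun i => (s(e i, blueEdge i (c i)), x i)
  have hinj : Function.Injective F := by
    intro i i' hii
    rcases Sym2.eq_iff.1 (Prod.mk.inj hii).1 with ⟨-, h2⟩ | ⟨h1, -⟩
    · have h3 : (i, c i) ∈ (blueEdge i' (c i')).1 := h2 ▸ (by simp [blueEdge])
      simp only [blueEdge, Sym2.mem_iff, Prod.mk.injEq] at h3
      rcases h3 with h3 | h3 <;> exact h3.1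
    · exact absurd (h1 ▸ he i) (hblue _ _)
  have hsub : Set.range F ⊆ D.redCrossings j := by
    rintro _ ⟨i, rfl⟩
    exact ⟨e i, he i, blueEdge i (c i), trivial, fun hb => hblue i (c i) (hb ▸ he i), rfl, hx i⟩
  refine le_trans (le_trans (le_of_eq ?_) hinj.encard_range) (Set.encard_le_encard hsub)
  simp [ENat.card_eq_coe_fintype_card]

end Drawing

/-! ### Counting, and the conclusion -/

open scoped Fin.CommRing in
/-- Given a sparse relation on `ℤ_n`, there is an element not far before `j` that is not related to
`j`, and one not far after `j` that is not related to any element in between. -/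
theorem exists_isLeast_sub_add {n d : ℕ} [NeZero n] (N : Fin n → Finset (Fin n))
    (hN : ∀ j, (N j).card ≤ d) (hn : 2 * (d + 2) ^ 2 + 1 ≤ n) (j : Fin n) :
    ∃ b a : Fin n, IsLeast {b : Fin n | j - b ≠ j ∧ j - b ∉ N j} b ∧
      IsLeast {a : Fin n | ∀ c ≤ b, j - c ≠ j + a ∧ j + a ∉ N (j - c)} a ∧
      2 * ((a : ℕ) + (b : ℕ)) < n := by
  have hleast : ∀ (S : Set (Fin n)) (T : ℕ), T < n → (∃ t ≤ T, (t : Fin n) ∈ S) →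
      ∃ x : Fin n, IsLeast S x ∧ (x : ℕ) ≤ T := by
    rintro S T hT ⟨t, ht, htS⟩
    classical
    have hne : (S.toFinite.toFinset).Nonempty := ⟨t, by simpa using htS⟩
    have hl := Finset.isLeast_min' _ hne
    rw [Set.Finite.coe_toFinset] at hl
    refine ⟨_, hl, ?_⟩
    have h1 : _ ≤ ((t : Fin n) : ℕ) := hl.2 htS
    rw [Fin.val_natCast, Nat.mod_eq_of_lt (by omega)] at h1
    omega
  have hcast : ∀ s t : ℕ, s < n → t < n → (s : Fin n) = t → s = t := by
    intro s t hs ht h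
    have := congrArg Fin.val h
    rwa [Fin.val_natCast, Fin.val_natCast, Nat.mod_eq_of_lt hs, Nat.mod_eq_of_lt ht] at this
  have hd : d + 1 < n := by nlinarith
  -- Of the d+1 elements just before j, at most d are in `N j`.
  obtain ⟨b, hb, hbd⟩ := hleast {b : Fin n | j - b ≠ j ∧ j - b ∉ N j} (d + 1) hd (by
    by_contra! hcon
    have hle : (Finset.Icc 1 (d + 1)).card ≤ (N j).card := by
      refine Finset.card_le_card_of_injOn (fun t => j - (t : Fin n)) ?_ ?_
      · intro t ht
        rw [Finset.mem_coe, Finset.mem_Icc] at ht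
        by_contra hnot
        refine hcon t ht.2 ⟨fun h => ?_, hnot⟩
        have := hcast t 0 (by omega) (by omega) (by simpa using h)
        omega
      · intro s hs t ht hst
        rw [Finset.mem_coe, Finset.mem_Icc] at hs ht
        exact hcast s t (by omega) (by omega) (sub_right_injective hst)
    have := hN j
    rw [Nat.card_Icc] at hle
    omega)
  -- One more than the number of elements that j-b, …, j can exclude through `N`. As T + b < n, the
  -- T elements after j do not wrap around to j-b.
  set T := ((b : ℕ) + 1) * d + 1 with hT
  have hTd : T ≤ (d + 2) * d + 1 := by
    have : ((b : ℕ) + 1) * d ≤ (d + 2) * d := Nat.mul_le_mul_right _ (by omega)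
    omega
  have hTb : 2 * (T + (b : ℕ)) < n := by nlinarith
  obtain ⟨a, ha, haT⟩ := hleast {a : Fin n | ∀ c ≤ b, j - c ≠ j + a ∧ j + a ∉ N (j - c)} T
    (by omega) (by
    by_contra! hcon
    classical
    have hle : (Finset.Icc 1 T).card ≤ ((Finset.Iic b).biUnion fun c => N (j - c)).card := by
      refine Finset.card_le_card_of_injOn (fun t => j + (t : Fin n)) ?_ ?_
      · intro t ht
        rw [Finset.mem_coe, Finset.mem_Icc] at ht
        by_contra hnot
        rw [Finset.mem_coe, Finset.mem_biUnion] at hnot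
        push Not at hnot
        refine hcon t ht.2 fun c hc => ⟨fun h => ?_, hnot c (Finset.mem_Iic.2 hc)⟩
        have h1 : (((c : ℕ) + t : ℕ) : Fin n) = ((0 : ℕ) : Fin n) := by
          push_cast
          have h2 : j = j + (c + t) := by
            calc j = (j - c) + c := by abel
              _ = j + (c + t) := by rw [h]; abel
          exact left_eq_add.1 h2
        have hcb : (c : ℕ) ≤ b := hc
        have := hcast _ _ (by omega) (by omega) h1
        omega
      · intro s hs t ht hst
        rw [Finset.mem_coe, Finset.mem_Icc] at hs ht
        exact hcast s t (by omega) (by omega) (add_right_injective _ hst)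
    have hle' := hle.trans (Finset.card_biUnion_le_card_mul _ _ d fun c _ => hN (j - c))
    rw [Nat.card_Icc, Fin.card_Iic] at hle'
    omega)
  exact ⟨b, a, hb, ha, by omega⟩

theorem proposition13 (m n : ℕ) (hm : 3 ≤ m) (hn : ((m : ℝ) + 3) ^ 2 / 2 + 1 ≤ (n : ℝ))
    (D : Drawing (cycleProduct m n)) (hD : D.AllIntersectionsCross) :
    D.Robust ∨ ∃ j : Fin n, (m : ℕ∞) ≤ (D.redCrossings j).encard := by
  rw [or_iff_not_imp_right]
  intro hlt
  push Not at hlt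
  have hn' : (m + 3) ^ 2 + 2 ≤ 2 * n := by
    have : ((m : ℝ) + 3) ^ 2 + 2 ≤ 2 * n := by linarith
    exact_mod_cast this
  -- From here on the cycle lengths are m+2 and n+2, the form in which adjacency means a difference
  -- of ±1.
  obtain ⟨m, rfl⟩ := Nat.exists_eq_add_of_le' (show 2 ≤ m by omega)
  obtain ⟨n, rfl⟩ := Nat.exists_eq_add_of_le' (show 2 ≤ n by nlinarith)
  refine ⟨fun j k l hjk hjl _ hsep => ?_, fun j => ?_⟩
  · exact (hlt j).not_ge
      (Drawing.le_encard_redCrossings_of_separates (by nlinarith) hjk hjl hsep)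
  -- The largest d with 2d below the red length m+2. Then 2(d+2) is at most that length plus 3,
  -- which is where the bound on n comes from.
  · obtain ⟨d, hd⟩ : ∃ d, d = (m + 1) / 2 := ⟨_, rfl⟩
    have hcard : ∀ j, (D.redNeighbors j).card ≤ d := by
      intro j
      have h := (hD.two_mul_card_redNeighbors_le (by omega) j).trans_lt (hlt j)
      have h' : 2 * (D.redNeighbors j).card < m + 2 := by exact_mod_cast h
      omega
    have hdn : 2 * (d + 2) ^ 2 + 1 ≤ n + 2 := by
      have : 2 * (d + 2) ≤ m + 2 + 3 := by omega
      nlinarith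
    have hmem : ∀ k l : Fin (n + 2), (k ≠ l ∧ k ∉ D.redNeighbors l) ↔
        (k ≠ l ∧ D.inter (redEdges k) (redEdges l) = ∅) := by
      intro k l
      refine and_congr_right fun hkl => ?_
      simp [Drawing.redNeighbors, hkl]
    obtain ⟨b, a, hb, ha, hab⟩ := exists_isLeast_sub_add D.redNeighbors hcard hdn j
    refine ⟨b, a, ?_, ?_, ?_⟩
    · simpa only [Drawing.IsB, hmem] using hb
    · have hmem' : ∀ c a : Fin (n + 2), (j - c ≠ j + a ∧ j + a ∉ D.redNeighbors (j - c)) ↔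
          (j - c ≠ j + a ∧ D.inter (redEdges (j - c)) (redEdges (j + a)) = ∅) := by
        intro c a
        rw [ne_comm, hmem, D.inter_eq_empty_comm]
      simpa only [Drawing.IsA, hmem'] using ha
    · have h : (2 : ℝ) * (((a : ℕ) : ℝ) + ((b : ℕ) : ℝ)) < ((n + 2 : ℕ) : ℝ) := by
        exact_mod_cast hab
      linarith
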